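/- Fix a dimension $d\ge 1$. For a finite set $P\subset[0,1]^d$ with at least two points let $h(P)=\sup_{x\in[0,1]^d}\min_{y\in P}\|x-y\|_2$, $q(P)=\tfrac12\min_{x\ne y\in P}\|x-y\|_2$ and $\rho(P)=h(P)/q(P)$. A family $(P_i)_{i\ge1}$ of such sets with $|P_i|=N_i$ is called quasi-uniform if there are constants $c>1$ and $C>0$, independent of $i$, such that $N_i<N_{i+1}\le cN_i$ and $\rho(P_i)\le C$ for all $i$. For a prime $N$ and $a\in\{1,\dots,N-1\}$ let $z=(z_1,\dots,z_d)=(1,a,\dots,a^{d-1})\bmod N$, let $P_{N,a}=\{(\{nz_1/N\},\dots,\{nz_d/N\}):0\le n<N\}$ be the Korobov lattice point set ($\{\cdot\}$ is the fractional part), let $\Lambda_{N,a}=\frac1N z\mathbb Z+\mathbb Z^d$, and let $\Lambda_{N,a}^\perp=\{y\in\mathbb R^d: x\cdot y\in\mathbb Z\ \text{for all } x\in\Lambda_{N,a}\}$. Let $\lambda_1(\Lambda)$ be the first successive minimum of a lattice $\Lambda$ with respect to the Euclidean unit ball, that is, the length of its shortest non-zero vector. Given a score $s(a)$ for each $a\in\{1,\dots,N-1\}$,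 the exhaustive search starts with $s_{\max}=0$, $a^*=1$, runs through $a=1,\dots,N-1$ in this order, replaces $(s_{\max},a^*)$ by $(s(a),a)$ whenever $s(a)>s_{\max}$, and finally returns $a^*$. Let $N_i$ be the $i$-th smallest prime number. (i) If $a_i$ is returned by the exhaustive search for $N=N_i$ with the score $s(a)=\lambda_1(\Lambda_{N_i,a})\lambda_1(\Lambda_{N_i,a}^\perp)$, then $a_i\in\{1,\dots,N_i-1\}$ maximizes this score over $\{1,\dots,N_i-1\}$, and $(P_{N_i,a_i})_{i\ge1}$ is a quasi-uniform family of point sets. (ii) Let $1/4<\delta<1$, and for all $i$ and $a\in\{1,\dots,N_i-1\}$ take any LLL-reduced bases (with parameter $\delta$) of $\Lambda_{N_i,a}$ and of $\Lambda_{N_i,a}^\perp$. If $a_i$ is returned by the exhaustive search for $N=N_i$ with the score $s(a)=\|v_1\|_2\|v_1^\perp\|_2$, where $v_1$ and $v_1^\perp$ are shortest among the vectors of these two bases, then $a_i\in\{1,\dots,N_i-1\}$ and $(P_{N_i,a_i})_{i\ge1}$ is a quasi-uniform family of point sets. Here a basis $b_1,\dots,b_d$ with Gram–Schmidt vectors $b_k^*$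 and coefficients $\mu_{k,l}=\langle b_k,b_l^*\rangle/\|b_l^*\|_2^2$ is LLL-reduced with parameter $\delta$ if $|\mu_{k,l}|\le\frac12$ for $l<k$ and $\delta\|b_{k-1}^*\|_2^2\le\|b_k^*\|_2^2+\mu_{k,k-1}^2\|b_{k-1}^*\|_2^2$ for $2\le k\le d$. -/

import Mathlib

noncomputable section

/-- The unit cube `[0,1]^d` in Euclidean space. -/
def unitCube (d : ℕ) : Set (EuclideanSpace ℝ (Fin d)) :=
  {x | ∀ j, x j ∈ Set.Icc (0 : ℝ) 1}

/-- Covering radius (fill distance) of `P` with respect to the unit cube: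
`sup_{x ∈ [0,1]^d} min_{y ∈ P} ‖x - y‖₂`. -/
def coveringRadius {d : ℕ} (P : Set (EuclideanSpace ℝ (Fin d))) : ℝ :=
  sSup ((fun x => Metric.infDist x P) '' unitCube d)

/-- Separation radius of `P`: half of the smallest distance of two distinct points of `P`. -/
def separationRadius {d : ℕ} (P : Set (EuclideanSpace ℝ (Fin d))) : ℝ :=
  P.infsep / 2

/-- Mesh ratio `ρ(P) = h(P) / q(P)`, meaningful for sets with at least two points. -/
def meshRatio {d : ℕ} (P : Set (EuclideanSpace ℝ (Fin d))) : ℝ :=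
  coveringRadius P / separationRadius P

/-- `(P i)` is a quasi-uniform family of point sets in `[0,1]^d` with `|P i| = N i`.
The condition `2 ≤ N i` makes the mesh ratio meaningful. -/
structure IsQuasiUniformFamily {d : ℕ} (N : ℕ → ℕ)
    (P : ℕ → Set (EuclideanSpace ℝ (Fin d))) : Prop where
  subset_unitCube : ∀ i, P i ⊆ unitCube d
  two_le : ∀ i, 2 ≤ N i
  card_eq : ∀ i, (P i).ncard = N i
  strictMono : ∀ i, N i < N (i + 1)
  growth : ∃ c : ℝ, 1 < c ∧ ∀ i, (N (i + 1) : ℝ) ≤ c * (N i : ℝ)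
  meshRatio_le : ∃ C : ℝ, 0 < C ∧ ∀ i, meshRatio (P i) ≤ C

/-- The rank-1 lattice point set `{ ({n z_1 / N}, …, {n z_d / N}) : 0 ≤ n < N }`. -/
def rankOnePointSet {d : ℕ} (N : ℕ) (z : Fin d → ℕ) : Set (EuclideanSpace ℝ (Fin d)) :=
  {x | ∃ n : ℕ, n < N ∧ ∀ j, x j = Int.fract ((n : ℝ) * (z j : ℝ) / (N : ℝ))}

/-- The rank-1 lattice `(1/N) z ℤ + ℤ^d`. -/
def rankOneLattice {d : ℕ} (N : ℕ) (z : Fin d → ℕ) :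
    Submodule ℤ (EuclideanSpace ℝ (Fin d)) :=
  Submodule.span ℤ {WithLp.toLp 2 (fun j => (z j : ℝ) / (N : ℝ))} ⊔
    Submodule.span ℤ (Set.range (EuclideanSpace.basisFun (Fin d) ℝ))

/-- The Korobov generating vector `(1, a, a^2, …, a^{d-1}) mod N`. -/
def korobovVector (d N a : ℕ) : Fin d → ℕ := fun j => a ^ (j : ℕ) % N

/-- The Korobov lattice `Λ_a`. -/
def korobovLattice (d N a : ℕ) : Submodule ℤ (EuclideanSpace ℝ (Fin d)) :=
  rankOneLattice N (korobovVector d N a)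

/-- The Korobov lattice point set. -/
def korobovPointSet (d N a : ℕ) : Set (EuclideanSpace ℝ (Fin d)) :=
  rankOnePointSet N (korobovVector d N a)

/-- The dual lattice `{ y : x · y ∈ ℤ for all x ∈ Λ }`. -/
def dualLattice {d : ℕ} (L : Submodule ℤ (EuclideanSpace ℝ (Fin d))) :
    Submodule ℤ (EuclideanSpace ℝ (Fin d)) where
  carrier := {y | ∀ x ∈ L, ∃ k : ℤ, inner ℝ x y = (k : ℝ)}
  zero_mem' := fun x _ => ⟨0, by simp⟩
  add_mem' := by
    intro y z hy hz x hx
    obtain ⟨k, hk⟩ := hy x hx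
    obtain ⟨l, hl⟩ := hz x hx
    exact ⟨k + l, by rw [inner_add_right, hk, hl]; push_cast; rfl⟩
  smul_mem' := by
    intro c y hy x hx
    obtain ⟨k, hk⟩ := hy x hx
    refine ⟨c * k, ?_⟩
    rw [← Int.cast_smul_eq_zsmul ℝ c y, real_inner_smul_right, hk]
    push_cast
    rfl

/-- The `j`-th successive minimum with respect to the Euclidean unit ball:
`inf { r > 0 : dim span (Λ ∩ r B_d) ≥ j }`. -/
def successiveMinimum {d : ℕ} (L : Submodule ℤ (EuclideanSpace ℝ (Fin d))) (j : ℕ) : ℝ :=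
  sInf {r : ℝ | 0 < r ∧ j ≤ Module.finrank ℝ
    (Submodule.span ℝ ((L : Set (EuclideanSpace ℝ (Fin d))) ∩ Metric.closedBall 0 r))}

/-- `b` is a lattice basis of `L`. -/
def IsLatticeBasis {d : ℕ} (L : Submodule ℤ (EuclideanSpace ℝ (Fin d)))
    (b : Fin d → EuclideanSpace ℝ (Fin d)) : Prop :=
  LinearIndependent ℝ b ∧ Submodule.span ℤ (Set.range b) = L

/-- Gram–Schmidt coefficient `μ_{k,l} = ⟨b_k, b_l^*⟩ / ⟨b_l^*, b_l^*⟩`. -/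
def gramSchmidtCoeff {d : ℕ} (b : Fin d → EuclideanSpace ℝ (Fin d)) (k l : Fin d) : ℝ :=
  inner ℝ (b k) (InnerProductSpace.gramSchmidt ℝ b l) /
    ‖InnerProductSpace.gramSchmidt ℝ b l‖ ^ 2

/-- LLL-reducedness with parameter `δ`: size reduction and the Lovász condition. -/
structure IsLLLReduced {d : ℕ} (δ : ℝ) (b : Fin d → EuclideanSpace ℝ (Fin d)) : Prop where
  size_reduced : ∀ k l : Fin d, l < k → |gramSchmidtCoeff b k l| ≤ 1 / 2
  lovasz : ∀ k l : Fin d, (l : ℕ) + 1 = (k : ℕ) →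
    δ * ‖InnerProductSpace.gramSchmidt ℝ b l‖ ^ 2 ≤
      ‖InnerProductSpace.gramSchmidt ℝ b k‖ ^ 2 +
        gramSchmidtCoeff b k l ^ 2 * ‖InnerProductSpace.gramSchmidt ℝ b l‖ ^ 2

/-- The length of the shortest vector among the members of a basis. -/
def shortestLength {d : ℕ} (b : Fin d → EuclideanSpace ℝ (Fin d)) : ℝ := ⨅ j, ‖b j‖

open Classical in
/-- One pass of the search loop; the state is `(score_max, a^*)`. -/
def searchStep (score : ℕ → ℝ) (s : ℝ × ℕ) (a : ℕ) : ℝ × ℕ :=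
  if s.1 < score a then (score a, a) else s

/-- The exhaustive search: start with `score_max = 0`, `a^* = 1`, run through
`a = 1, …, N - 1`, and return `a^*`. -/
def exhaustiveSearch (score : ℕ → ℝ) (N : ℕ) : ℕ :=
  ((List.range' 1 (N - 1)).foldl (searchStep score) (0, 1)).2

/-- The exact score `λ_1(Λ_a) λ_1(Λ_a^⊥)`. -/
def exactScore (d N a : ℕ) : ℝ :=
  successiveMinimum (korobovLattice d N a) 1 *
    successiveMinimum (dualLattice (korobovLattice d N a)) 1

end

/-! The covering radius of a rank-one lattice is at most a constant over the shortest dual length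
(`exists_transference`), and distinct points of the point set are at least the shortest primal
length apart. So the mesh ratio is at most a constant, depending only on `d`, over the score, and it
suffices to bound the winning scores below uniformly in `N`.

As the search maximizes, one good parameter per prime is enough (`exists_good_korobov_parameter`). A
short dual vector is a small integral polynomial with root `a` modulo `N`. There are too few such
polynomials, each with at most `d` roots, to exclude every `a`, so some `a` has shortest dual length
of order `N ^ (1/d)`. Transference then gives covering radius of order `N ^ (-1/d)`. A much shorter
primal vector would make the `N` lattice points modulo `ℤ^d` cluster, leaving too few clusters to
cover the torus (`le_norm_of_covering`). Hence the product of the two minima is bounded below.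

For LLL scores, the shortest basis vector is no shorter than the first minimum, and exceeds it by at
most a factor depending on `δ` and `d` (`shortestLength_le_mul_norm`). The same argument applies
with a worse constant. -/

/-- Remove the component along `v`. -/
noncomputable def projAlong {E : Type*} [NormedAddCommGroup E] [InnerProductSpace ℝ E] (v : E) :
    E →ₗ[ℝ] E :=
  LinearMap.id - (‖v‖ ^ 2)⁻¹ • ((innerSL ℝ v).toLinearMap.smulRight v)

/-- Slack in the factor makes it unnecessary to show that the infimum of the nonzero lengths is
attained; `11 / 10` is close enough to `1` for the projection estimates below. -/
theorem exists_near_shortest {E : Type*} [NormedAddCommGroup E] {L : Submodule ℤ E} {r : ℝ} (hr : 0 < r)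
    (hL : ∀ x ∈ L, x ≠ 0 → r ≤ ‖x‖) (hne : L ≠ ⊥) :
    ∃ v ∈ L, v ≠ 0 ∧ ∀ w ∈ L, w ≠ 0 → ‖v‖ ≤ 11 / 10 * ‖w‖ := by
  obtain ⟨x₀, hx₀, hx₀'⟩ := (Submodule.ne_bot_iff _).1 hne
  set S : Set ℝ := {s | ∃ x ∈ L, x ≠ 0 ∧ ‖x‖ = s} with hS
  have hSne : S.Nonempty := ⟨_, x₀, hx₀, hx₀', rfl⟩
  have hb : r ∈ lowerBounds S := by
    rintro s ⟨x, hx, hx', rfl⟩; exact hL x hx hx'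
  have hpos : 0 < sInf S := hr.trans_le (le_csInf hSne hb)
  obtain ⟨_, ⟨v, hv, hv', rfl⟩, hlt⟩ :=
    exists_lt_of_csInf_lt hSne (show sInf S < 11 / 10 * sInf S by linarith)
  refine ⟨v, hv, hv', fun w hw hw' => hlt.le.trans ?_⟩
  have := csInf_le ⟨r, hb⟩ (show ‖w‖ ∈ S from ⟨w, hw, hw', rfl⟩)
  linarith

/-! ### Transference by induction on the rank, projecting along a nearly shortest vector. -/

section Transference

variable {E : Type*} [NormedAddCommGroup E] [InnerProductSpace ℝ E]

theorem projAlong_apply (v x : E) : projAlong v x = x - (inner ℝ v x / ‖v‖ ^ 2) • v := by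
  simp [projAlong, smul_smul, div_eq_inv_mul]

theorem inner_projAlong {v : E} (hv : v ≠ 0) (x : E) : inner ℝ v (projAlong v x) = 0 := by
  have : ‖v‖ ≠ 0 := norm_ne_zero_iff.2 hv
  rw [projAlong_apply, inner_sub_right, real_inner_smul_right, real_inner_self_eq_norm_sq]
  field_simp
  ring

theorem projAlong_self {v : E} (hv : v ≠ 0) : projAlong v v = 0 := by
  have : ‖v‖ ≠ 0 := norm_ne_zero_iff.2 hv
  rw [projAlong_apply, real_inner_self_eq_norm_sq, div_self (by positivity), one_smul, sub_self]

/-- Every vector can be moved by an integer multiple of `v` so that its component along `v`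
is at most half of `v`. -/
theorem exists_sub_zsmul_eq_projAlong_add {v : E} (hv : v ≠ 0) (x : E) :
    ∃ (k : ℤ) (θ : ℝ), |θ| ≤ 1 / 2 ∧ x - k • v = projAlong v x + θ • v ∧
      ‖x - k • v‖ ^ 2 = ‖projAlong v x‖ ^ 2 + θ ^ 2 * ‖v‖ ^ 2 := by
  have h : x - (round (inner ℝ v x / ‖v‖ ^ 2)) • v = projAlong v x +
      (inner ℝ v x / ‖v‖ ^ 2 - round (inner ℝ v x / ‖v‖ ^ 2)) • v := by
    rw [projAlong_apply, sub_smul, ← Int.cast_smul_eq_zsmul ℝ]; abel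
  refine ⟨_, _, abs_sub_round _, h, ?_⟩
  rw [h, norm_add_sq_real, real_inner_smul_right, real_inner_comm v, inner_projAlong hv, norm_smul,
    Real.norm_eq_abs, mul_pow, sq_abs]
  ring

/-- Transference: a lower bound `m` for the length of nonzero dual vectors bounds both the covering
radius and the first minimum of a lattice. -/
theorem exists_transference [FiniteDimensional ℝ E] (n : ℕ) :
    ∃ C : ℝ, 0 < C ∧ ∀ (L : Submodule ℤ E) (r m : ℝ), 0 < r → (∀ x ∈ L, x ≠ 0 → r ≤ ‖x‖) →
      Module.finrank ℝ (Submodule.span ℝ (L : Set E)) ≤ n → 0 < m →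
      (∀ y ∈ Submodule.span ℝ (L : Set E), y ≠ 0 → (∀ x ∈ L, ∃ k : ℤ, inner ℝ x y = (k : ℝ)) →
        m ≤ ‖y‖) →
      (∀ t ∈ Submodule.span ℝ (L : Set E), ∃ x ∈ L, ‖t - x‖ ≤ C / m) ∧
      (L ≠ ⊥ → ∃ x ∈ L, x ≠ 0 ∧ ‖x‖ ≤ C / m) := by
  induction n with
  | zero =>
    refine ⟨1, one_pos, fun L r m _ _ hn hm _ => ?_⟩
    have h0 : Submodule.span ℝ (L : Set E) = ⊥ := Submodule.finrank_eq_zero.1 (by omega)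
    refine ⟨fun t ht => ⟨0, L.zero_mem, ?_⟩, fun hne => ?_⟩
    · rw [h0, Submodule.mem_bot] at ht
      simp [ht, hm.le]
    · obtain ⟨x₀, hx₀, hx₀'⟩ := (Submodule.ne_bot_iff _).1 hne
      have : x₀ ∈ Submodule.span ℝ (L : Set E) := Submodule.subset_span hx₀
      rw [h0, Submodule.mem_bot] at this
      exact absurd this hx₀'
  | succ n ih =>
    obtain ⟨C, hC, ih⟩ := ih
    refine ⟨2 * C + 1, by positivity, fun L r m hr hL hn hm hdual => ?_⟩
    rcases eq_or_ne L ⊥ with rfl | hne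
    · refine ⟨fun t ht => ⟨0, Submodule.zero_mem _, ?_⟩, fun h => absurd rfl h⟩
      have : t = 0 := by simpa using ht
      rw [this]; simp; positivity
    obtain ⟨v, hvL, hv, hshort⟩ := exists_near_shortest hr hL hne
    have hvpos : 0 < ‖v‖ := norm_pos_iff.2 hv
    set L' : Submodule ℤ E := L.map ((projAlong v).restrictScalars ℤ) with hL'
    have hspan : Submodule.span ℝ (L' : Set E) = (Submodule.span ℝ (L : Set E)).map (projAlong v) := by
      rw [Submodule.map_span]; rfl
    have hvV : v ∈ Submodule.span ℝ (L : Set E) := Submodule.subset_span hvL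
    have hle : Submodule.span ℝ (L' : Set E) ≤ Submodule.span ℝ (L : Set E) := by
      rw [hspan]
      rintro _ ⟨x, hx, rfl⟩
      rw [projAlong_apply]
      exact Submodule.sub_mem _ hx (Submodule.smul_mem _ _ hvV)
    have horth : ∀ y ∈ Submodule.span ℝ (L' : Set E), inner ℝ v y = 0 := by
      rw [hspan]
      rintro _ ⟨x, hx, rfl⟩
      exact inner_projAlong hv x
    have hlt : Submodule.span ℝ (L' : Set E) < Submodule.span ℝ (L : Set E) := by
      refine lt_of_le_of_ne hle fun h => ?_
      have := horth v (h ▸ hvV)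
      exact hv (inner_self_eq_zero.1 this)
    have hn' : Module.finrank ℝ (Submodule.span ℝ (L' : Set E)) ≤ n := by
      have := Submodule.finrank_lt_finrank_of_lt hlt
      omega
    -- Projection keeps the lattice discrete: a short projection would lift, with `v`-component at
    -- most `‖v‖ / 2`, to a lattice vector too short compared with `v`.
    have hsep : ∀ p ∈ L', p ≠ 0 → ‖v‖ ≤ 2 * ‖p‖ := by
      rintro _ ⟨x, hx, rfl⟩ hp
      change projAlong v x ≠ 0 at hp
      change ‖v‖ ≤ 2 * ‖projAlong v x‖
      obtain ⟨k, θ, hθ, hw, hnorm⟩ := exists_sub_zsmul_eq_projAlong_add hv x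
      have hwL : x - k • v ∈ L := L.sub_mem hx (L.smul_mem k hvL)
      have hw0 : x - k • v ≠ 0 := by
        intro h0
        apply hp
        have := congrArg (projAlong v) h0
        rwa [map_sub, map_zsmul, projAlong_self hv, smul_zero, sub_zero, map_zero] at this
      have h1 := hshort _ hwL hw0
      have h2 : θ ^ 2 ≤ 1 / 4 := by
        rw [← sq_abs]; nlinarith [abs_nonneg θ]
      have h3 : θ ^ 2 * ‖v‖ ^ 2 ≤ 1 / 4 * ‖v‖ ^ 2 := by gcongr
      have h4 : ‖v‖ ^ 2 ≤ (11 / 10 * ‖x - k • v‖) ^ 2 := by gcongr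
      refine le_of_sq_le_sq ?_ (by positivity)
      nlinarith [sq_nonneg ‖v‖]
    -- Dual vectors of the projection are orthogonal to `v`, hence already dual to `L`, so `m` is
    -- inherited unchanged.
    have hdual' : ∀ y ∈ Submodule.span ℝ (L' : Set E), y ≠ 0 →
        (∀ x ∈ L', ∃ k : ℤ, inner ℝ x y = (k : ℝ)) → m ≤ ‖y‖ := by
      intro y hy hy0 hyd
      refine hdual y (hle hy) hy0 fun x hx => ?_
      obtain ⟨k, hk⟩ := hyd _ (Submodule.mem_map_of_mem hx)
      refine ⟨k, ?_⟩
      rw [← hk]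
      change _ = inner ℝ (projAlong v x) y
      rw [projAlong_apply, inner_sub_left, real_inner_smul_left, horth y hy, mul_zero, sub_zero]
    obtain ⟨hcov, hmin⟩ := ih L' (‖v‖ / 2) m (by positivity)
      (fun p hp hp0 => by linarith [hsep p hp hp0]) hn' hm hdual'
    have hvm : ‖v‖ ≤ (2 * C + 1) / m := by
      -- If the projection vanishes, `L` is generated by `v` and `v / ‖v‖ ^ 2` is a dual vector of
      -- length `1 / ‖v‖`. Otherwise `hsep` and the induction hypothesis bound `‖v‖`.
      rcases eq_or_ne L' ⊥ with hbot | hne'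
      · have hd : m ≤ ‖(‖v‖ ^ 2)⁻¹ • v‖ := by
          refine hdual _ (Submodule.smul_mem _ _ hvV) (smul_ne_zero (by positivity) hv) fun x hx => ?_
          obtain ⟨k, θ, hθ, hw, hnorm⟩ := exists_sub_zsmul_eq_projAlong_add hv x
          have hp : projAlong v x = 0 := by
            have : projAlong v x ∈ L' := ⟨x, hx, rfl⟩
            rwa [hbot, Submodule.mem_bot] at this
          have hwL : x - k • v ∈ L := L.sub_mem hx (L.smul_mem k hvL)
          have hw0 : x - k • v = 0 := by
            by_contra h0
            have h1 := hshort _ hwL h0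
            rw [hw, hp, zero_add, norm_smul, Real.norm_eq_abs] at h1
            nlinarith
          refine ⟨k, ?_⟩
          rw [sub_eq_zero.1 hw0, ← Int.cast_smul_eq_zsmul ℝ, real_inner_smul_left,
            real_inner_smul_right, real_inner_self_eq_norm_sq]
          field_simp
        rw [norm_smul, norm_inv, norm_pow, norm_norm] at hd
        have h5 : (‖v‖ ^ 2)⁻¹ * ‖v‖ = 1 / ‖v‖ := by field_simp
        rw [h5, le_div_iff₀ hvpos] at hd
        rw [le_div_iff₀ hm]
        nlinarith
      · obtain ⟨p, hp, hp0, hpm⟩ := hmin hne'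
        calc ‖v‖ ≤ 2 * ‖p‖ := hsep p hp hp0
          _ ≤ 2 * (C / m) := by gcongr
          _ = 2 * C / m := by ring
          _ ≤ _ := by gcongr; linarith
    -- Approximate the projection of `t`, lift, and round along `v`; the rounding costs at most `‖v‖
    -- / 2`.
    refine ⟨fun t ht => ?_, fun _ => ⟨v, hvL, hv, hvm⟩⟩
    obtain ⟨_, ⟨x, hx, rfl⟩, hxt⟩ := hcov (projAlong v t) (by rw [hspan]; exact ⟨t, ht, rfl⟩)
    change ‖projAlong v t - projAlong v x‖ ≤ C / m at hxt
    rw [← map_sub] at hxt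
    obtain ⟨k, θ, hθ, hw, -⟩ := exists_sub_zsmul_eq_projAlong_add hv (t - x)
    refine ⟨x + k • v, L.add_mem hx (L.smul_mem k hvL), ?_⟩
    rw [← sub_sub, hw]
    calc _ ≤ ‖projAlong v (t - x)‖ + ‖θ • v‖ := norm_add_le _ _
      _ ≤ C / m + 1 / 2 * ((2 * C + 1) / m) := by
        rw [norm_smul, Real.norm_eq_abs]; gcongr
      _ = (2 * C + 1 / 2) / m := by ring
      _ ≤ _ := by gcongr; norm_num

end Transference

/-! ### Correctness of the search loop. -/

section Search

theorem foldl_searchStep (score : ℕ → ℝ) (l : List ℕ) (s : ℝ × ℕ) :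
    s.1 ≤ (l.foldl (searchStep score) s).1 ∧
    (∀ b ∈ l, score b ≤ (l.foldl (searchStep score) s).1) ∧
    (l.foldl (searchStep score) s = s ∨
      ((l.foldl (searchStep score) s).2 ∈ l ∧
        (l.foldl (searchStep score) s).1 = score (l.foldl (searchStep score) s).2)) := by
  induction l generalizing s with
  | nil => simp
  | cons a l ih =>
    obtain ⟨h1, h2, h3⟩ := ih (searchStep score s a)
    rw [List.foldl_cons]
    have hs : s.1 ≤ (searchStep score s a).1 ∧ score a ≤ (searchStep score s a).1 ∧
        (searchStep score s a = s ∨ searchStep score s a = (score a, a)) := by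
      unfold searchStep
      split_ifs with h
      · exact ⟨h.le, le_rfl, Or.inr rfl⟩
      · exact ⟨le_rfl, not_lt.1 h, Or.inl rfl⟩
    refine ⟨hs.1.trans h1, ?_, ?_⟩
    · intro b hb
      rcases List.mem_cons.1 hb with rfl | hb
      · exact hs.2.1.trans h1
      · exact h2 b hb
    · rcases h3 with h3 | h3
      · rcases hs.2.2 with h4 | h4
        · left; rw [h3, h4]
        · right; rw [h3, h4]; simp
      · right; exact ⟨List.mem_cons_of_mem _ h3.1, h3.2⟩

theorem exhaustiveSearch_mem (score : ℕ → ℝ) {N : ℕ} (hN : 2 ≤ N) :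
    exhaustiveSearch score N ∈ Finset.Icc 1 (N - 1) := by
  rw [Finset.mem_Icc]
  rcases (foldl_searchStep score (List.range' 1 (N - 1)) (0, 1)).2.2 with h | h
  · rw [exhaustiveSearch, h]; simp; omega
  · have := List.mem_range'_1.1 h.1
    rw [exhaustiveSearch]; omega

theorem le_exhaustiveSearch (score : ℕ → ℝ) {N : ℕ}
    (hpos : ∃ b ∈ Finset.Icc 1 (N - 1), 0 < score b) :
    ∀ b ∈ Finset.Icc 1 (N - 1), score b ≤ score (exhaustiveSearch score N) := by
  have hmem : ∀ b ∈ Finset.Icc 1 (N - 1), b ∈ List.range' 1 (N - 1) := fun b hb => by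
    rw [Finset.mem_Icc] at hb
    rw [List.mem_range'_1]; omega
  obtain ⟨-, h2, h3⟩ := foldl_searchStep score (List.range' 1 (N - 1)) (0, 1)
  intro b hb
  rcases h3 with h | h
  -- The loop keeps its initial state `(0, 1)` only if no score is positive.
  · obtain ⟨c, hc, hc0⟩ := hpos
    have := h2 c (hmem c hc)
    rw [h] at this
    exact absurd hc0 (not_lt.2 this)
  · rw [exhaustiveSearch, ← h.2]
    exact h2 b (hmem b hb)

end Search

/-! ### The first successive minimum as a shortest length. -/

section FirstMinimum

variable {d : ℕ} {L : Submodule ℤ (EuclideanSpace ℝ (Fin d))}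

theorem one_le_finrank_span_inter_closedBall_iff {r : ℝ} :
    1 ≤ Module.finrank ℝ (Submodule.span ℝ
      ((L : Set (EuclideanSpace ℝ (Fin d))) ∩ Metric.closedBall 0 r)) ↔
      ∃ x ∈ L, x ≠ 0 ∧ ‖x‖ ≤ r := by
  rw [Nat.one_le_iff_ne_zero, Ne, Submodule.finrank_eq_zero, Submodule.span_eq_bot]
  push Not
  constructor
  · rintro ⟨x, ⟨hx, hr⟩, h0⟩
    exact ⟨x, hx, h0, by simpa using hr⟩
  · rintro ⟨x, hx, h0, hr⟩
    exact ⟨x, ⟨hx, by simpa using hr⟩, h0⟩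

/-- For `L = ⊥` the infimum is over the empty set and takes the default value `0`. -/
theorem le_successiveMinimum_one {m : ℝ} (hL : L ≠ ⊥) (h : ∀ x ∈ L, x ≠ 0 → m ≤ ‖x‖) :
    m ≤ successiveMinimum L 1 := by
  obtain ⟨x, hx, h0⟩ := (Submodule.ne_bot_iff _).1 hL
  refine le_csInf ⟨‖x‖, norm_pos_iff.2 h0,
    one_le_finrank_span_inter_closedBall_iff.2 ⟨x, hx, h0, le_rfl⟩⟩ ?_
  rintro r ⟨-, hr⟩
  obtain ⟨y, hy, hy0, hyr⟩ := one_le_finrank_span_inter_closedBall_iff.1 hr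
  exact (h y hy hy0).trans hyr

theorem successiveMinimum_one_le {x : EuclideanSpace ℝ (Fin d)} (hx : x ∈ L) (h0 : x ≠ 0) :
    successiveMinimum L 1 ≤ ‖x‖ :=
  csInf_le ⟨0, fun _ hr => hr.1.le⟩ ⟨norm_pos_iff.2 h0,
    one_le_finrank_span_inter_closedBall_iff.2 ⟨x, hx, h0, le_rfl⟩⟩

end FirstMinimum

/-! ### Quality of LLL-reduced bases. -/

section LLL

open InnerProductSpace

variable {d : ℕ} {b : Fin d → EuclideanSpace ℝ (Fin d)}

/-- Since `μ ^ 2 ≤ 1 / 4`, the Lovász condition lets consecutive squared Gram–Schmidt lengths shrink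
by at most the factor `δ - 1 / 4`. -/
theorem norm_gramSchmidt_zero_sq_le {δ : ℝ} (hδ : 1 / 4 < δ) (hb : IsLLLReduced δ b)
    (hd : 0 < d) (n : ℕ) (hn : n < d) :
    ‖b ⟨0, hd⟩‖ ^ 2 ≤ (1 / (δ - 1 / 4)) ^ n * ‖gramSchmidt ℝ b ⟨n, hn⟩‖ ^ 2 := by
  have hpos : 0 < δ - 1 / 4 := by linarith
  induction n with
  | zero =>
    have : gramSchmidt ℝ b ⟨0, hd⟩ = b ⟨0, hd⟩ := by
      rw [gramSchmidt_def, Finset.sum_eq_zero, sub_zero]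
      intro i hi
      exact absurd (Finset.mem_Iio.1 hi) (by simp [Fin.lt_def])
    rw [this]; simp
  | succ n ih =>
    have ih := ih (by omega)
    have h1 := hb.lovasz ⟨n + 1, hn⟩ ⟨n, by omega⟩ rfl
    have h2 := hb.size_reduced ⟨n + 1, hn⟩ ⟨n, by omega⟩ (by simp [Fin.lt_def])
    set μ := gramSchmidtCoeff b ⟨n + 1, hn⟩ ⟨n, by omega⟩
    have h3 : μ ^ 2 ≤ 1 / 4 := by rw [← sq_abs]; nlinarith [abs_nonneg μ]
    refine ih.trans ?_
    rw [pow_succ (1 / (δ - 1 / 4)), mul_assoc]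
    refine mul_le_mul_of_nonneg_left ?_ (by positivity)
    rw [one_div_mul_eq_div, le_div_iff₀ hpos]
    nlinarith [mul_le_mul_of_nonneg_right h3 (sq_nonneg ‖gramSchmidt ℝ b ⟨n, by omega⟩‖)]

/-- Take `k` to be the last index with nonzero coefficient. The inner product of `x` with the `k`-th
Gram–Schmidt vector is that nonzero integer times its squared length, and Cauchy–Schwarz concludes.
-/
theorem exists_norm_gramSchmidt_le (hb : LinearIndependent ℝ b) {x : EuclideanSpace ℝ (Fin d)}
    (hx : x ∈ Submodule.span ℤ (Set.range b)) (h0 : x ≠ 0) :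
    ∃ k, ‖gramSchmidt ℝ b k‖ ≤ ‖x‖ := by
  obtain ⟨c, rfl⟩ := (Submodule.mem_span_range_iff_exists_fun ℤ).1 hx
  have hne : (Finset.univ.filter fun i => c i ≠ 0).Nonempty := by
    by_contra h
    rw [Finset.not_nonempty_iff_eq_empty, Finset.filter_eq_empty_iff] at h
    refine h0 (Finset.sum_eq_zero fun i hi => ?_)
    rw [not_not.1 (h hi), zero_smul]
  set k := (Finset.univ.filter fun i => c i ≠ 0).max' hne with hk
  have hck : c k ≠ 0 := (Finset.mem_filter.1 (Finset.max'_mem _ hne)).2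
  have hgt : ∀ i, k < i → c i = 0 := fun i hi => by
    by_contra h
    exact absurd (Finset.le_max' _ i (Finset.mem_filter.2 ⟨Finset.mem_univ _, h⟩)) (not_le.2 hi)
  have hinner : inner ℝ (gramSchmidt ℝ b k) (∑ i, c i • b i) =
      c k * ‖gramSchmidt ℝ b k‖ ^ 2 := by
    rw [inner_sum, Finset.sum_eq_single k]
    · rw [← Int.cast_smul_eq_zsmul ℝ, real_inner_smul_right]
      congr 1
      conv_lhs => rw [gramSchmidt_def' ℝ b k]
      rw [inner_add_right, real_inner_self_eq_norm_sq, inner_sum, Finset.sum_eq_zero, add_zero]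
      intro i hi
      have hik : i < k := Finset.mem_Iio.1 hi
      obtain ⟨e, he⟩ := Submodule.mem_span_singleton.1
        (Submodule.starProjection_apply_mem (Submodule.span ℝ {gramSchmidt ℝ b i}) (b k))
      rw [← he, real_inner_smul_right, gramSchmidt_orthogonal ℝ b hik.ne', mul_zero]
    · intro i _ hik
      rw [← Int.cast_smul_eq_zsmul ℝ, real_inner_smul_right]
      rcases lt_or_gt_of_ne hik with h | h
      · rw [gramSchmidt_inv_triangular ℝ b h, mul_zero]
      · rw [hgt i h, Int.cast_zero, zero_mul]
    · simp
  have hpos : 0 < ‖gramSchmidt ℝ b k‖ := norm_pos_iff.2 (gramSchmidt_ne_zero k hb)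
  refine ⟨k, ?_⟩
  have h1 := abs_real_inner_le_norm (gramSchmidt ℝ b k) (∑ i, c i • b i)
  rw [hinner, abs_mul, abs_of_pos (by positivity : 0 < ‖gramSchmidt ℝ b k‖ ^ 2)] at h1
  have h2 : (1 : ℝ) ≤ |(c k : ℝ)| := by
    exact_mod_cast Int.one_le_abs hck
  have h3 : 1 * ‖gramSchmidt ℝ b k‖ ^ 2 ≤ |(c k : ℝ)| * ‖gramSchmidt ℝ b k‖ ^ 2 := by gcongr
  nlinarith

theorem shortestLength_le_mul_norm {δ : ℝ} (hδ : 1 / 4 < δ) (hδ1 : δ < 1)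
    {L : Submodule ℤ (EuclideanSpace ℝ (Fin d))} (hL : IsLatticeBasis L b)
    (hb : IsLLLReduced δ b) {x : EuclideanSpace ℝ (Fin d)} (hx : x ∈ L) (h0 : x ≠ 0) :
    shortestLength b ≤ (1 / (δ - 1 / 4)) ^ d * ‖x‖ := by
  have hpos : 0 < δ - 1 / 4 := by linarith
  have hα : 1 ≤ 1 / (δ - 1 / 4) := by rw [le_div_iff₀ hpos]; linarith
  rw [← hL.2] at hx
  obtain ⟨k, hk⟩ := exists_norm_gramSchmidt_le hL.1 hx h0
  have hd : 0 < d := k.pos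
  have h1 := norm_gramSchmidt_zero_sq_le hδ hb hd k k.2
  have h2 : shortestLength b ≤ ‖b ⟨0, hd⟩‖ :=
    ciInf_le ⟨0, by rintro _ ⟨j, rfl⟩; exact norm_nonneg _⟩ _
  refine h2.trans (le_of_sq_le_sq (h1.trans ?_) (by positivity))
  rw [mul_pow]
  gcongr
  rw [← pow_mul]
  exact pow_le_pow_right₀ hα (by have := k.2; omega)

theorem le_shortestLength (hd : 0 < d) {m : ℝ} {L : Submodule ℤ (EuclideanSpace ℝ (Fin d))}
    (hL : IsLatticeBasis L b) (h : ∀ x ∈ L, x ≠ 0 → m ≤ ‖x‖) : m ≤ shortestLength b := by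
  have : Nonempty (Fin d) := ⟨⟨0, hd⟩⟩
  refine le_ciInf fun j => h _ ?_ (hL.1.ne_zero j)
  rw [← hL.2]
  exact Submodule.subset_span ⟨j, rfl⟩

end LLL

/-! ### Rank-one lattices, their duals, and the mesh ratio of their point sets. -/

section RankOne

variable {d : ℕ}

theorem abs_apply_le_norm (x : EuclideanSpace ℝ (Fin d)) (j : Fin d) : |x j| ≤ ‖x‖ := by
  simpa using PiLp.norm_apply_le x j

theorem norm_le_sqrt_mul {x : EuclideanSpace ℝ (Fin d)} {s : ℝ} (hs : 0 ≤ s)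
    (h : ∀ j, |x j| ≤ s) : ‖x‖ ≤ √d * s := by
  rw [EuclideanSpace.norm_eq]
  refine Real.sqrt_le_iff.2 ⟨by positivity, ?_⟩
  rw [mul_pow, Real.sq_sqrt (by positivity)]
  calc _ ≤ ∑ _j : Fin d, s ^ 2 := by
        refine Finset.sum_le_sum fun j _ => ?_
        rw [Real.norm_eq_abs]
        gcongr
        exact h j
    _ = _ := by simp

/-- A nonzero vector with integral coordinates has length at least `1`. -/
theorem one_le_norm_of_int {x : EuclideanSpace ℝ (Fin d)} (h0 : x ≠ 0) (k : Fin d → ℤ)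
    (h : ∀ j, x j = (k j : ℝ)) : 1 ≤ ‖x‖ := by
  obtain ⟨j, hj⟩ : ∃ j, x j ≠ 0 := by
    by_contra hx
    push Not at hx
    exact h0 (by ext j; simpa using hx j)
  refine le_trans ?_ (abs_apply_le_norm x j)
  have hk : k j ≠ 0 := fun e => hj (by rw [h j, e, Int.cast_zero])
  have h1 : (1 : ℝ) ≤ |(k j : ℝ)| := by exact_mod_cast Int.one_le_abs hk
  rwa [h j]

theorem mem_rankOneLattice_iff {N : ℕ} {z : Fin d → ℕ} {x : EuclideanSpace ℝ (Fin d)} :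
    x ∈ rankOneLattice N z ↔
      ∃ (n : ℤ) (k : Fin d → ℤ), ∀ j, x j = n * ((z j : ℝ) / N) + (k j : ℝ) := by
  have hint : ∀ y : EuclideanSpace ℝ (Fin d),
      y ∈ Submodule.span ℤ (Set.range (EuclideanSpace.basisFun (Fin d) ℝ)) ↔
        ∃ k : Fin d → ℤ, ∀ j, y j = (k j : ℝ) := by
    intro y
    rw [Submodule.mem_span_range_iff_exists_fun]
    refine exists_congr fun k => ?_
    have : ∀ j, (∑ i, k i • EuclideanSpace.basisFun (Fin d) ℝ i) j = (k j : ℝ) := by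
      intro j
      simp [← Int.cast_smul_eq_zsmul ℝ, EuclideanSpace.basisFun_apply, Finset.sum_apply,
        Pi.single_apply]
    constructor
    · rintro rfl j
      exact this j
    · intro h
      ext j
      rw [this j, h j]
  rw [rankOneLattice, Submodule.mem_sup]
  constructor
  · rintro ⟨u, hu, w, hw, rfl⟩
    obtain ⟨n, rfl⟩ := Submodule.mem_span_singleton.1 hu
    obtain ⟨k, hk⟩ := (hint w).1 hw
    exact ⟨n, k, fun j => by simp [hk j]⟩
  · rintro ⟨n, k, h⟩
    refine ⟨n • WithLp.toLp 2 (fun j => (z j : ℝ) / (N : ℝ)),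
      Submodule.mem_span_singleton.2 ⟨n, rfl⟩, WithLp.toLp 2 (fun j => (k j : ℝ)),
      (hint _).2 ⟨k, fun j => rfl⟩, ?_⟩
    ext j
    simp [h j]

theorem inv_le_norm_of_mem_rankOneLattice {N : ℕ} (hN : 0 < N) {z : Fin d → ℕ}
    {x : EuclideanSpace ℝ (Fin d)} (hx : x ∈ rankOneLattice N z) (h0 : x ≠ 0) :
    1 / (N : ℝ) ≤ ‖x‖ := by
  obtain ⟨n, k, h⟩ := mem_rankOneLattice_iff.1 hx
  have hN' : (0 : ℝ) < N := by exact_mod_cast hN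
  have h1 : 1 ≤ ‖(N : ℝ) • x‖ := by
    refine one_le_norm_of_int (smul_ne_zero hN'.ne' h0) (fun j => n * z j + N * k j) fun j => ?_
    simp only [PiLp.smul_apply, h j, smul_eq_mul]
    push_cast
    field_simp
  rw [norm_smul, Real.norm_eq_abs, abs_of_pos hN'] at h1
  rw [div_le_iff₀ hN']
  linarith

theorem basisFun_mem_rankOneLattice (N : ℕ) (z : Fin d → ℕ) (j : Fin d) :
    EuclideanSpace.basisFun (Fin d) ℝ j ∈ rankOneLattice N z :=
  Submodule.mem_sup_right (Submodule.subset_span ⟨j, rfl⟩)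

theorem span_rankOneLattice (N : ℕ) (z : Fin d → ℕ) :
    Submodule.span ℝ (rankOneLattice N z : Set (EuclideanSpace ℝ (Fin d))) = ⊤ := by
  rw [eq_top_iff, ← (EuclideanSpace.basisFun (Fin d) ℝ).toBasis.span_eq]
  refine Submodule.span_mono ?_
  rintro _ ⟨j, rfl⟩
  simpa using basisFun_mem_rankOneLattice N z j

theorem rankOneLattice_ne_bot (hd : 0 < d) (N : ℕ) (z : Fin d → ℕ) : rankOneLattice N z ≠ ⊥ :=
  (Submodule.ne_bot_iff _).2 ⟨_, basisFun_mem_rankOneLattice N z ⟨0, hd⟩,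
    by simp⟩

/-- Dual vectors are integral and orthogonal to the generating vector modulo `N`. -/
theorem exists_int_of_mem_dualLattice {N : ℕ} (hN : 0 < N) {z : Fin d → ℕ}
    {y : EuclideanSpace ℝ (Fin d)} (hy : y ∈ dualLattice (rankOneLattice N z)) :
    ∃ h : Fin d → ℤ, (∀ j, y j = (h j : ℝ)) ∧ (N : ℤ) ∣ ∑ j, h j * z j := by
  have hN' : (N : ℝ) ≠ 0 := by exact_mod_cast hN.ne'
  have h1 : ∀ j, ∃ k : ℤ, y j = (k : ℝ) := fun j => by
    obtain ⟨k, hk⟩ := hy _ (basisFun_mem_rankOneLattice N z j)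
    exact ⟨k, by simpa [EuclideanSpace.basisFun_apply, EuclideanSpace.inner_single_left] using hk⟩
  choose h hh using h1
  refine ⟨h, hh, ?_⟩
  obtain ⟨k, hk⟩ := hy (WithLp.toLp 2 (fun j => (z j : ℝ) / (N : ℝ)))
    (mem_rankOneLattice_iff.2 ⟨1, 0, fun j => by simp⟩)
  refine ⟨k, ?_⟩
  have : ((∑ j, h j * z j : ℤ) : ℝ) = N * k := by
    rw [← hk, PiLp.inner_apply, Finset.mul_sum]
    push_cast
    refine Finset.sum_congr rfl fun j _ => ?_
    simp [hh j]
    field_simp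
  exact_mod_cast this

theorem one_le_norm_of_mem_dualLattice {N : ℕ} (hN : 0 < N) {z : Fin d → ℕ}
    {y : EuclideanSpace ℝ (Fin d)} (hy : y ∈ dualLattice (rankOneLattice N z)) (h0 : y ≠ 0) :
    1 ≤ ‖y‖ := by
  obtain ⟨h, hh, -⟩ := exists_int_of_mem_dualLattice hN hy
  exact one_le_norm_of_int h0 h hh

theorem dualLattice_rankOneLattice_ne_bot (hd : 0 < d) {N : ℕ} (hN : 0 < N) (z : Fin d → ℕ) :
    dualLattice (rankOneLattice N z) ≠ ⊥ := by
  have hN' : (N : ℝ) ≠ 0 := by exact_mod_cast hN.ne'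
  refine (Submodule.ne_bot_iff _).2 ⟨EuclideanSpace.single ⟨0, hd⟩ (N : ℝ), ?_, ?_⟩
  · intro x hx
    obtain ⟨n, k, h⟩ := mem_rankOneLattice_iff.1 hx
    refine ⟨n * z ⟨0, hd⟩ + N * k ⟨0, hd⟩, ?_⟩
    rw [EuclideanSpace.inner_single_right, h]
    push_cast
    simp
    field_simp
  · simpa using hN.ne'

/-- The covering radius of a rank-one lattice is controlled by its shortest dual vector. -/
theorem exists_rankOneLattice_covering (d : ℕ) :
    ∃ C : ℝ, 0 < C ∧ ∀ (N : ℕ) (z : Fin d → ℕ) (m : ℝ), 0 < N → 0 < m →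
      (∀ y ∈ dualLattice (rankOneLattice N z), y ≠ 0 → m ≤ ‖y‖) →
      ∀ t, ∃ x ∈ rankOneLattice N z, ‖t - x‖ ≤ C / m := by
  obtain ⟨C, hC, h⟩ := exists_transference (E := EuclideanSpace ℝ (Fin d)) d
  refine ⟨C, hC, fun N z m hN hm hdual t => ?_⟩
  have hN' : (0 : ℝ) < N := by exact_mod_cast hN
  refine (h (rankOneLattice N z) (1 / N) m (by positivity)
    (fun x hx h0 => inv_le_norm_of_mem_rankOneLattice hN hx h0) ?_ hm
    (fun y _ hy0 hy => hdual y hy hy0)).1 t ?_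
  · rw [span_rankOneLattice]; simp
  · rw [span_rankOneLattice]; trivial

theorem rankOnePointSet_subset_unitCube (N : ℕ) (z : Fin d → ℕ) :
    rankOnePointSet N z ⊆ unitCube d := by
  rintro x ⟨n, -, h⟩ j
  rw [h j]
  exact ⟨Int.fract_nonneg _, (Int.fract_lt_one _).le⟩

theorem rankOnePointSet_subset_rankOneLattice (N : ℕ) (z : Fin d → ℕ) :
    rankOnePointSet N z ⊆ rankOneLattice N z := by
  rintro x ⟨n, -, h⟩
  refine mem_rankOneLattice_iff.2 ⟨n, fun j => -⌊(n : ℝ) * (z j : ℝ) / (N : ℝ)⌋, fun j => ?_⟩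
  rw [h j, Int.fract]
  push_cast
  ring

theorem mem_rankOnePointSet_of_mem_rankOneLattice {N : ℕ} (hN : 0 < N) {z : Fin d → ℕ}
    {x : EuclideanSpace ℝ (Fin d)} (hx : x ∈ rankOneLattice N z)
    (h01 : ∀ j, x j ∈ Set.Ico (0 : ℝ) 1) : x ∈ rankOnePointSet N z := by
  obtain ⟨n, k, h⟩ := mem_rankOneLattice_iff.1 hx
  have hN' : (N : ℝ) ≠ 0 := by exact_mod_cast hN.ne'
  have hNz : (0 : ℤ) < N := by exact_mod_cast hN
  refine ⟨(n % N).toNat, ?_, fun j => ?_⟩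
  · have := Int.emod_lt_of_pos n hNz
    have := Int.emod_nonneg n hNz.ne'
    omega
  · have h1 : (((n % N).toNat : ℕ) : ℝ) = n - N * (n / N : ℤ) := by
      have h2 : (((n % N).toNat : ℕ) : ℤ) = n - N * (n / N) := by
        rw [Int.toNat_of_nonneg (Int.emod_nonneg n hNz.ne'), Int.emod_def]
      exact_mod_cast h2
    rw [← Int.fract_eq_self.2 (h01 j), Int.fract_eq_fract]
    refine ⟨k j + z j * (n / N), ?_⟩
    rw [h j, h1]
    push_cast
    field_simp
    ring

theorem ncard_rankOnePointSet {N : ℕ} (hN : 0 < N) {z : Fin d → ℕ} {j₀ : Fin d}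
    (hz : z j₀ = 1) : (rankOnePointSet N z).ncard = N := by
  have hN' : (0 : ℝ) < N := by exact_mod_cast hN
  have himg : rankOnePointSet N z = (fun n : ℕ => (WithLp.toLp 2
      (fun j => Int.fract ((n : ℝ) * (z j : ℝ) / (N : ℝ))) : EuclideanSpace ℝ (Fin d))) ''
        (Finset.range N : Set ℕ) := by
    ext x
    constructor
    · rintro ⟨n, hn, h⟩
      exact ⟨n, by simpa using hn, by ext j; simp [h j]⟩
    · rintro ⟨n, hn, rfl⟩
      exact ⟨n, by simpa using hn, fun j => rfl⟩
  rw [himg, Set.InjOn.ncard_image, Set.ncard_coe_finset, Finset.card_range]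
  have hfr : ∀ n : ℕ, n < N → Int.fract ((n : ℝ) * (z j₀ : ℝ) / (N : ℝ)) = n / N := by
    intro n hn
    rw [hz, Nat.cast_one, mul_one, Int.fract_eq_self]
    exact ⟨by positivity, by rw [div_lt_one hN']; exact_mod_cast hn⟩
  intro n hn n' hn' h
  have h1 := congrArg (fun x : EuclideanSpace ℝ (Fin d) => x j₀) h
  simp only [Finset.coe_range, Set.mem_Iio] at hn hn'
  simp only at h1
  rw [hfr n hn, hfr n' hn', div_left_inj' hN'.ne'] at h1
  exact_mod_cast h1

/-- A lattice point near `x` may lie outside the cube. For small `μ`, first contract the cube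
towards its centre, leaving a margin `2 * μ`; a lattice point within `μ` of the contracted point
stays inside. For `μ ≥ 1 / 4` the diameter `√d` suffices. -/
theorem coveringRadius_rankOnePointSet_le {N : ℕ} (hN : 0 < N) {z : Fin d → ℕ} {μ : ℝ}
    (hμ : 0 < μ) (hcov : ∀ t, ∃ x ∈ rankOneLattice N z, ‖t - x‖ ≤ μ) :
    coveringRadius (rankOnePointSet N z) ≤ (4 * √d + 1) * μ := by
  refine csSup_le (Set.Nonempty.image _ ⟨0, fun j => by simp⟩) ?_
  rintro _ ⟨x, hx, rfl⟩
  rcases le_or_gt (1 / 4) μ with h4 | h4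
  · have h0 : (0 : EuclideanSpace ℝ (Fin d)) ∈ rankOnePointSet N z :=
      ⟨0, hN, fun j => by simp⟩
    calc Metric.infDist x _ ≤ dist x 0 := Metric.infDist_le_dist_of_mem h0
      _ = ‖x‖ := dist_zero_right x
      _ ≤ √d * 1 := norm_le_sqrt_mul zero_le_one fun j => by
          rw [abs_of_nonneg (hx j).1]; exact (hx j).2
      _ ≤ √d * (4 * μ) := by gcongr; linarith
      _ ≤ _ := by nlinarith
  · set x' : EuclideanSpace ℝ (Fin d) :=
      WithLp.toLp 2 (fun j => 2 * μ + (1 - 4 * μ) * x j) with hx'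
    obtain ⟨y, hy, hxy⟩ := hcov x'
    have hyP : y ∈ rankOnePointSet N z := by
      refine mem_rankOnePointSet_of_mem_rankOneLattice hN hy fun j => ?_
      have h1 := (abs_apply_le_norm (x' - y) j).trans hxy
      have h2 : (x' - y) j = 2 * μ + (1 - 4 * μ) * x j - y j := rfl
      rw [h2, abs_le] at h1
      have h3 := (hx j).1
      have h5 := (hx j).2
      constructor <;> nlinarith
    have hxx' : ‖x - x'‖ ≤ √d * (2 * μ) := by
      refine norm_le_sqrt_mul (by positivity) fun j => ?_
      have h2 : (x - x') j = x j - (2 * μ + (1 - 4 * μ) * x j) := rfl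
      have h3 := (hx j).1
      have h5 := (hx j).2
      rw [h2, abs_le]
      constructor <;> nlinarith
    calc Metric.infDist x _ ≤ dist x y := Metric.infDist_le_dist_of_mem hyP
      _ = ‖(x - x') + (x' - y)‖ := by rw [dist_eq_norm]; congr 1; abel
      _ ≤ ‖x - x'‖ + ‖x' - y‖ := norm_add_le _ _
      _ ≤ √d * (2 * μ) + μ := by gcongr
      _ ≤ _ := by nlinarith [mul_nonneg (Real.sqrt_nonneg d) hμ.le]

theorem le_infsep_rankOnePointSet {N : ℕ} {z : Fin d → ℕ} {m : ℝ}
    (hnt : (rankOnePointSet N z).Nontrivial)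
    (h : ∀ x ∈ rankOneLattice N z, x ≠ 0 → m ≤ ‖x‖) : m ≤ (rankOnePointSet N z).infsep := by
  refine hnt.le_infsep fun x hx y hy hxy => ?_
  rw [dist_eq_norm]
  exact h _ (Submodule.sub_mem _ (rankOnePointSet_subset_rankOneLattice N z hx)
    (rankOnePointSet_subset_rankOneLattice N z hy)) (sub_ne_zero.2 hxy)

/-- The mesh ratio is bounded in terms of the shortest primal and dual vectors. -/
theorem exists_meshRatio_rankOnePointSet_le (d : ℕ) :
    ∃ C : ℝ, 0 < C ∧ ∀ (N : ℕ) (z : Fin d → ℕ) (m m' : ℝ), 0 < m → 0 < m' →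
      (rankOnePointSet N z).Nontrivial →
      (∀ x ∈ rankOneLattice N z, x ≠ 0 → m ≤ ‖x‖) →
      (∀ y ∈ dualLattice (rankOneLattice N z), y ≠ 0 → m' ≤ ‖y‖) →
      meshRatio (rankOnePointSet N z) ≤ C / (m * m') := by
  obtain ⟨C, hC, h⟩ := exists_rankOneLattice_covering d
  refine ⟨2 * ((4 * √d + 1) * C), by positivity, fun N z m m' hm hm' hnt hp hdual => ?_⟩
  have hN : 0 < N := by
    obtain ⟨x, n, hn, -⟩ := hnt.nonempty
    omega
  have h1 := coveringRadius_rankOnePointSet_le hN (z := z) (div_pos hC hm')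
    (h N z m' hN hm' hdual)
  have h2 := le_infsep_rankOnePointSet hnt hp
  calc meshRatio (rankOnePointSet N z) ≤ (4 * √d + 1) * (C / m') / (m / 2) := by
        unfold meshRatio separationRadius
        gcongr
    _ = _ := by field_simp

end RankOne

/-! ### Existence of a parameter with large primal and dual minima. -/

section GoodParameter

open Polynomial in
/-- A parameter `a` avoiding the roots of all small nonzero integral polynomials. -/
theorem exists_forall_lt_abs_of_dvd {d N T : ℕ} (hN : N.Prime) (hT : T < N)
    (hcard : d * ((2 * T + 1) ^ d - 1) < N - 1) :
    ∃ a ∈ Finset.Icc 1 (N - 1), ∀ h : Fin d → ℤ, h ≠ 0 →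
      (N : ℤ) ∣ ∑ j, h j * (korobovVector d N a j : ℤ) → ∃ j, (T : ℤ) < |h j| := by
  classical
  have : Fact N.Prime := ⟨hN⟩
  -- The Korobov vector consists of powers of `a`, so the divisibility condition says that `a` is a
  -- root of `p h` modulo `N`.
  let p : (Fin d → ℤ) → (ZMod N)[X] := fun h => ∑ j, C (h j : ZMod N) * X ^ (j : ℕ)
  have hcoeff : ∀ h j, (p h).coeff (j : Fin d) = h j := by
    intro h j
    simp [p, coeff_X_pow, Fin.val_inj]
  have hdeg : ∀ h, (p h).natDegree ≤ d := by
    intro h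
    refine natDegree_sum_le_of_forall_le _ _ fun j _ => ?_
    exact (natDegree_C_mul_X_pow_le _ _).trans j.2.le
  let H : Finset (Fin d → ℤ) := (Fintype.piFinset fun _ => Finset.Icc (-(T : ℤ)) T).erase 0
  have hH : H.card = (2 * T + 1) ^ d - 1 := by
    rw [Finset.card_erase_of_mem, Fintype.card_piFinset]
    · simp
      congr 2
      omega
    · simp
  let bad : Finset (ZMod N) := H.biUnion fun h => (p h).roots.toFinset
  have hbad : bad.card ≤ ((2 * T + 1) ^ d - 1) * d := by
    rw [← hH]
    refine Finset.card_biUnion_le_card_mul _ _ _ fun h _ => ?_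
    exact (Multiset.toFinset_card_le _).trans ((card_roots' _).trans (hdeg h))
  obtain ⟨α, hα, hαbad⟩ : ∃ α ∈ (Finset.univ.erase (0 : ZMod N)), α ∉ bad := by
    refine Finset.exists_mem_notMem_of_card_lt_card ?_
    rw [Finset.card_erase_of_mem (Finset.mem_univ _), Finset.card_univ, ZMod.card]
    rw [mul_comm] at hbad
    omega
  have hα0 : α ≠ 0 := (Finset.mem_erase.1 hα).1
  refine ⟨α.val, ?_, fun h h0 hdvd => ?_⟩
  · have h1 := ZMod.val_lt α
    have h2 : α.val ≠ 0 := by rwa [Ne, ZMod.val_eq_zero]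
    rw [Finset.mem_Icc]; omega
  · by_contra hsmall
    push Not at hsmall
    apply hαbad
    have hmem : h ∈ H := by
      refine Finset.mem_erase.2 ⟨h0, Fintype.mem_piFinset.2 fun j => ?_⟩
      rw [Finset.mem_Icc]
      exact abs_le.1 (hsmall j)
    refine Finset.mem_biUnion.2 ⟨h, hmem, ?_⟩
    -- Coefficients of size at most `T < N` cannot all vanish modulo `N` unless `h = 0`.
    have hp0 : p h ≠ 0 := by
      intro hp
      apply h0
      funext j
      have h1 := hcoeff h j
      rw [hp, coeff_zero] at h1
      have h2 : (N : ℤ) ∣ h j := (ZMod.intCast_zmod_eq_zero_iff_dvd _ _).1 h1.symm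
      refine Int.eq_zero_of_abs_lt_dvd h2 ((hsmall j).trans_lt ?_)
      exact_mod_cast hT
    rw [Multiset.mem_toFinset, mem_roots hp0, IsRoot.def, eval_finsetSum]
    have h3 := (ZMod.intCast_zmod_eq_zero_iff_dvd _ N).2 hdvd
    rw [← h3]
    push_cast
    refine Finset.sum_congr rfl fun j _ => ?_
    simp [korobovVector]

/-- If every point is within `μ` of a rank-one lattice and `K` multiples of the lattice vector `x`
stay within `μ` of the origin, a grid that is coarse relative to `μ` has at most `N / K + 1`
points. -/
theorem pow_le_of_covering {d N K M : ℕ} {z : Fin d → ℕ} (hN : N.Prime) (hM : 0 < M)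
    (hK : 0 < K) {μ : ℝ} {x : EuclideanSpace ℝ (Fin d)}
    (hcov : ∀ t, ∃ y ∈ rankOneLattice N z, ‖t - y‖ ≤ μ)
    (hx : x ∈ rankOneLattice N z) (h0 : x ≠ 0) (hx1 : ‖x‖ < 1) (hKx : K * ‖x‖ ≤ μ)
    (hMμ : 4 * μ * M < 1) : M ^ d ≤ N / K + 1 := by
  have hM' : (0 : ℝ) < M := by exact_mod_cast hM
  have hNz : (N : ℤ) ≠ 0 := by exact_mod_cast hN.ne_zero
  have hN' : (N : ℝ) ≠ 0 := by exact_mod_cast hN.ne_zero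
  obtain ⟨n₀, k₀, hx'⟩ := mem_rankOneLattice_iff.1 hx
  -- Otherwise `x` would be integral, contradicting `‖x‖ < 1`. As `N` is prime, `x` then generates
  -- the lattice modulo `ℤ^d`.
  have hn₀ : ¬ (N : ℤ) ∣ n₀ := by
    rintro ⟨c, rfl⟩
    refine absurd (one_le_norm_of_int h0 (fun j => c * z j + k₀ j) fun j => ?_) (not_le.2 hx1)
    rw [hx' j]
    push_cast
    field_simp
  have hcop : IsCoprime n₀ (N : ℤ) :=
    ((Nat.prime_iff_prime_int.1 hN).coprime_iff_not_dvd.2 hn₀).symm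
  obtain ⟨u, w, huw⟩ := hcop
  -- The lattice point near `t` is `i • x` modulo `ℤ^d` with `i < N`. Replacing `i` by `K * (i / K)`
  -- moves it by at most another `μ`, so `N / K + 1` centres suffice.
  have key : ∀ t : EuclideanSpace ℝ (Fin d), ∃ q : Fin (N / K + 1), ∃ k : Fin d → ℤ,
      ∀ j, |t j - (K * (q : ℕ)) * x j - k j| ≤ 2 * μ := by
    intro t
    obtain ⟨y, hy, hty⟩ := hcov t
    obtain ⟨n, k, hy'⟩ := mem_rankOneLattice_iff.1 hy
    obtain ⟨i, hi⟩ := Int.eq_ofNat_of_zero_le (Int.emod_nonneg (n * u) hNz)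
    have hiN : i < N := by
      have := Int.emod_lt_of_pos (n * u) (show (0 : ℤ) < N by exact_mod_cast hN.pos)
      omega
    have hdiv : i = K * (i / K) + i % K := (Nat.div_add_mod i K).symm
    have hmod : n * u = N * (n * u / N) + i := by
      rw [← hi]; exact (Int.mul_ediv_add_emod _ _).symm
    set e := n * u / N
    refine ⟨⟨i / K, Nat.lt_succ_of_le (Nat.div_le_div_right hiN.le)⟩,
      fun j => e * n₀ * z j + n * w * z j + k j - i * k₀ j, fun j => ?_⟩
    have hyx : y j - i * x j = ((e * n₀ * z j + n * w * z j + k j - i * k₀ j : ℤ) : ℝ) := by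
      have h1 : (n : ℝ) = n * u * n₀ + n * w * N := by
        have : n = n * u * n₀ + n * w * N := by linear_combination (-n) * huw
        exact_mod_cast this
      have h2 : (n : ℝ) * u = N * e + i := by exact_mod_cast hmod
      rw [h2] at h1
      rw [hy' j, hx' j, h1]
      push_cast
      field_simp
      ring
    have hiR : (i : ℝ) = K * (i / K : ℕ) + (i % K : ℕ) := by exact_mod_cast hdiv
    have h4 : |t j - y j| ≤ μ := (abs_apply_le_norm (t - y) j).trans hty
    have h5 : |((i % K : ℕ) : ℝ) * x j| ≤ μ := by
      rw [abs_mul, Nat.abs_cast]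
      refine le_trans ?_ hKx
      gcongr
      · exact (Nat.mod_lt i hK).le
      · exact abs_apply_le_norm x j
    rw [← hyx]
    have h6 : t j - K * (i / K : ℕ) * x j - (y j - i * x j) =
        (t j - y j) + ((i % K : ℕ) : ℝ) * x j := by
      rw [hiR]; ring
    rw [h6]
    linarith [abs_add_le (t j - y j) (((i % K : ℕ) : ℝ) * x j)]
  let t : (Fin d → Fin M) → EuclideanSpace ℝ (Fin d) :=
    fun g => WithLp.toLp 2 (fun j => ((g j : ℕ) : ℝ) / M)
  choose q k hqk using fun g => key (t g)
  -- Grid points sharing a centre differ by at most `4 * μ < 1 / M` in each coordinate modulo `1`,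
  -- hence coincide.
  have hinj : Function.Injective q := by
    intro g g' hgg
    funext j
    have h1 := hqk g j
    have h2 := hqk g' j
    rw [← hgg] at h2
    have h3 : |((g j : ℕ) : ℝ) / M - ((g' j : ℕ) : ℝ) / M - (k g j - k g' j)| ≤ 4 * μ := by
      have h4 : ((g j : ℕ) : ℝ) / M - ((g' j : ℕ) : ℝ) / M - (k g j - k g' j) =
          (t g j - K * (q g : ℕ) * x j - k g j) - (t g' j - K * (q g : ℕ) * x j - k g' j) := by
        simp only [t]; ring
      rw [h4]
      linarith [abs_sub (t g j - K * (q g : ℕ) * x j - k g j)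
        (t g' j - K * (q g : ℕ) * x j - k g' j)]
    have h5 : |(((g j : ℕ) - (g' j : ℕ) - M * (k g j - k g' j) : ℤ) : ℝ)| < 1 := by
      have h6 : (((g j : ℕ) - (g' j : ℕ) - M * (k g j - k g' j) : ℤ) : ℝ) =
          M * (((g j : ℕ) : ℝ) / M - ((g' j : ℕ) : ℝ) / M - (k g j - k g' j)) := by
        push_cast; field_simp
      rw [h6, abs_mul, Nat.abs_cast]
      nlinarith
    have h7 : ((g j : ℕ) - (g' j : ℕ) - M * (k g j - k g' j) : ℤ) = 0 := by
      rw [← Int.abs_lt_one_iff]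
      exact_mod_cast h5
    have h8 : (M : ℤ) ∣ ((g j : ℕ) - (g' j : ℕ) : ℤ) := ⟨k g j - k g' j, by linarith⟩
    have h9 : ((g j : ℕ) - (g' j : ℕ) : ℤ) = 0 := by
      refine Int.eq_zero_of_abs_lt_dvd h8 ?_
      have := (g j).2
      have := (g' j).2
      rw [abs_lt]
      omega
    exact Fin.ext (by omega)
  simpa using Fintype.card_le_of_injective q hinj

/-- A covering radius of the optimal order `N ^ (-1/d)` forces a first minimum of the same order. -/
theorem le_norm_of_covering {d N : ℕ} {z : Fin d → ℕ} (hd : 0 < d) (hN : N.Prime) {X D : ℝ}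
    (hX : 1 ≤ X) (hXN : X ^ d = N) (hD : 1 ≤ D)
    (hcov : ∀ t, ∃ y ∈ rankOneLattice N z, ‖t - y‖ ≤ D / X)
    {x : EuclideanSpace ℝ (Fin d)} (hx : x ∈ rankOneLattice N z) (h0 : x ≠ 0) :
    1 / (4 * (10 * D) ^ d * X) ≤ ‖x‖ := by
  set F := (10 * D) ^ d with hF
  have hF1 : 1 ≤ F := one_le_pow₀ (by linarith)
  have hNpos : (0 : ℝ) < N := by exact_mod_cast hN.pos
  have hxpos : 0 < ‖x‖ := norm_pos_iff.2 h0
  have hXpos : 0 < X := by linarith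
  -- For small `N` the trivial bound `1 / N` is enough.
  by_cases hlarge : (N : ℝ) < 2 * F
  · refine le_trans ?_ (inv_le_norm_of_mem_rankOneLattice hN.pos hx h0)
    gcongr
    nlinarith
  push Not at hlarge
  by_contra! hsmall
  have hxX : ‖x‖ * (4 * F * X) < 1 := by rwa [lt_div_iff₀ (by positivity)] at hsmall
  have hx1 : ‖x‖ < 1 := by
    refine lt_of_le_of_lt ?_ hxX
    refine le_mul_of_one_le_right hxpos.le ?_
    nlinarith
  have hX10 : 10 * D ≤ X := by
    refine le_of_pow_le_pow_left₀ hd.ne' hXpos.le ?_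
    rw [hXN]; linarith
  -- `M` keeps `4 * (D / X) * M` at most `4 / 5` while `M ^ d ≥ N / F`; `K` exceeds `2 * F` when `x`
  -- is too short. The count then gives `N / F < N / (2 * F) + 1`, contradicting `N ≥ 2 * F`.
  set M := ⌊X / (5 * D)⌋₊ with hM
  set K := ⌊D / X / ‖x‖⌋₊ with hK
  have hM1 : (M : ℝ) ≤ X / (5 * D) := Nat.floor_le (by positivity)
  have hM2 : X / (10 * D) ≤ M := by
    have h1 := Nat.lt_floor_add_one (X / (5 * D))
    have h2 : 1 ≤ X / (10 * D) := by rw [le_div_iff₀ (by positivity)]; linarith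
    have h3 : X / (5 * D) = 2 * (X / (10 * D)) := by field_simp; norm_num
    rw [← hM] at h1
    linarith
  have hM0 : 0 < M := by
    have : (0 : ℝ) < M := lt_of_lt_of_le (by positivity) hM2
    exact_mod_cast this
  have hratio : 4 * F < D / X / ‖x‖ := by
    rw [lt_div_iff₀ hxpos, lt_div_iff₀ hXpos]
    nlinarith
  have hK1 : (K : ℝ) ≤ D / X / ‖x‖ := Nat.floor_le (by positivity)
  have hK2 : 2 * F < K := by
    have h1 := Nat.lt_floor_add_one (D / X / ‖x‖)
    rw [← hK] at h1
    linarith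
  have hKpos : (0 : ℝ) < K := by linarith
  have hcount := pow_le_of_covering hN hM0 (by exact_mod_cast hKpos) hcov hx h0 hx1
    (by rwa [le_div_iff₀ hxpos] at hK1) (by
      calc 4 * (D / X) * M ≤ 4 * (D / X) * (X / (5 * D)) := by gcongr
        _ = 4 / 5 := by field_simp
        _ < 1 := by norm_num)
  have hcount' : (M : ℝ) ^ d ≤ N / K + 1 := by
    have h1 : (M : ℝ) ^ d ≤ ((N / K : ℕ) : ℝ) + 1 := by exact_mod_cast hcount
    linarith [@Nat.cast_div_le ℝ _ _ _ N K]
  have hlow : (N : ℝ) / F ≤ (M : ℝ) ^ d := by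
    rw [← hXN, hF, ← div_pow]
    gcongr
  have h1 : (N : ℝ) / K < N / (2 * F) := by gcongr
  have h2 : (N : ℝ) / F = 2 * (N / (2 * F)) := by field_simp
  have h3 : 1 ≤ (N : ℝ) / (2 * F) := by rw [le_div_iff₀ (by positivity)]; linarith
  linarith

/-- For every prime there is a Korobov parameter for which both the lattice and its dual have long
shortest vectors. -/
theorem exists_good_korobov_parameter {d : ℕ} (hd : 0 < d) :
    ∃ c : ℝ, 0 < c ∧ ∀ N : ℕ, N.Prime → ∃ a ∈ Finset.Icc 1 (N - 1), ∃ m m' : ℝ,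
      0 < m ∧ 0 < m' ∧ c ≤ m * m' ∧
      (∀ x ∈ korobovLattice d N a, x ≠ 0 → m ≤ ‖x‖) ∧
      (∀ y ∈ dualLattice (korobovLattice d N a), y ≠ 0 → m' ≤ ‖y‖) := by
  obtain ⟨C, hC, hcov⟩ := exists_rankOneLattice_covering d
  have hd' : (1 : ℝ) ≤ d := by exact_mod_cast hd
  set D : ℝ := C * (6 * d) + 1 with hD
  have hD1 : 1 ≤ D := by rw [hD]; linarith [show 0 < C * (6 * d) by positivity]
  refine ⟨1 / (4 * (10 * D) ^ d) / (6 * d), by positivity, fun N hN => ?_⟩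
  have hN1 : (1 : ℝ) ≤ N := by exact_mod_cast hN.one_le
  set X : ℝ := (N : ℝ) ^ ((d : ℝ)⁻¹) with hXdef
  have hXN : X ^ d = N := Real.rpow_inv_natCast_pow (by positivity) hd.ne'
  have hX : 1 ≤ X := Real.one_le_rpow hN1 (by positivity)
  have hXleN : X ≤ N := by rw [← hXN]; exact le_self_pow₀ hX hd.ne'
  -- With `6 * d`, for `T ≥ 1` one has `2 * T + 1 ≤ 3 * T ≤ X / (2 * d)`, so at most half of the
  -- residues are excluded. For `T = 0` no polynomial is excluded.
  set T := ⌊X / (6 * d)⌋₊ with hT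
  have hT1 : (T : ℝ) ≤ X / (6 * d) := Nat.floor_le (by positivity)
  have hT2 : X / (6 * d) < T + 1 := Nat.lt_floor_add_one _
  have hTN : T < N := by
    have h1 : X / (6 * d) < X := by
      rw [div_lt_iff₀ (by positivity)]; nlinarith
    have : (T : ℝ) < N := by linarith
    exact_mod_cast this
  have hcard : d * ((2 * T + 1) ^ d - 1) < N - 1 := by
    rcases Nat.eq_zero_or_pos T with h | h
    · have := hN.two_le
      rw [h]; simp; omega
    · have hT' : (1 : ℝ) ≤ T := by exact_mod_cast h
      have h1 : (2 * T + 1 : ℝ) ≤ X / (2 * d) := by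
        have : X / (2 * d) = 3 * (X / (6 * d)) := by field_simp; norm_num
        linarith
      have h2 : (2 * T + 1 : ℝ) ^ d ≤ N / (2 * d) := by
        calc (2 * T + 1 : ℝ) ^ d ≤ (X / (2 * d)) ^ d := by gcongr
          _ = N / (2 * d) ^ d := by rw [div_pow, hXN]
          _ ≤ N / (2 * d) := by
            gcongr
            exact le_self_pow₀ (by linarith) hd.ne'
      have h3 : (d : ℝ) * (2 * T + 1) ^ d ≤ N / 2 := by
        calc (d : ℝ) * (2 * T + 1) ^ d ≤ d * (N / (2 * d)) := by gcongr
          _ = N / 2 := by field_simp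
      have h4 : 2 * (d * (2 * T + 1) ^ d) ≤ N := by
        have : (2 * (d * (2 * T + 1) ^ d) : ℝ) ≤ N := by linarith
        exact_mod_cast this
      have h5 := hN.two_le
      rw [Nat.mul_sub]
      omega
  obtain ⟨a, ha, hgood⟩ := exists_forall_lt_abs_of_dvd hN hTN hcard
  have hdual : ∀ y ∈ dualLattice (korobovLattice d N a), y ≠ 0 → X / (6 * d) ≤ ‖y‖ := by
    intro y hy h0
    obtain ⟨h, hh, hdvd⟩ := exists_int_of_mem_dualLattice hN.pos hy
    obtain ⟨j, hj⟩ := hgood h (fun h00 => h0 (by ext j; simp [hh j, h00])) hdvd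
    refine hT2.le.trans (le_trans ?_ (abs_apply_le_norm y j))
    have hj' : (T : ℝ) + 1 ≤ |(h j : ℝ)| := by exact_mod_cast Int.add_one_le_iff.2 hj
    rwa [hh j]
  refine ⟨a, ha, 1 / (4 * (10 * D) ^ d * X), X / (6 * d), by positivity, by positivity, ?_, ?_,
    hdual⟩
  · apply le_of_eq; field_simp
  · intro x hx h0
    refine le_norm_of_covering hd hN hX hXN hD1 (fun t => ?_) hx h0
    obtain ⟨y, hy, hty⟩ := hcov N _ (X / (6 * d)) hN.pos (by positivity) hdual t
    refine ⟨y, hy, hty.trans ?_⟩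
    have : C / (X / (6 * d)) = C * (6 * d) / X := by field_simp
    rw [this]
    gcongr
    linarith

end GoodParameter

/-! ### From bounded scores to a quasi-uniform family. -/

section Family

/-- Bertrand's postulate; it supplies the growth constant `2`. -/
theorem nth_prime_succ_le_two_mul (i : ℕ) :
    Nat.nth Nat.Prime (i + 1) ≤ 2 * Nat.nth Nat.Prime i := by
  obtain ⟨p, hp, hlt, hle⟩ := Nat.exists_prime_lt_and_le_two_mul (Nat.nth Nat.Prime i)
    (Nat.prime_nth_prime i).ne_zero
  refine le_trans ?_ hle
  by_contra! h
  exact absurd (Nat.le_nth_of_lt_nth_succ h hp) (not_le.2 hlt)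

theorem ncard_korobovPointSet {d N a : ℕ} (hd : 0 < d) (hN : 2 ≤ N) :
    (korobovPointSet d N a).ncard = N := by
  refine ncard_rankOnePointSet (by omega) (j₀ := ⟨0, hd⟩) ?_
  simp [korobovVector, Nat.mod_eq_of_lt hN]

/-- Korobov point sets with a score bounded below form a quasi-uniform family. -/
theorem isQuasiUniformFamily_korobovPointSet {d : ℕ} (hd : 0 < d) {a : ℕ → ℕ} {c : ℝ} (hc : 0 < c)
    {m m' : ℕ → ℝ} (hm : ∀ i, 0 < m i) (hm' : ∀ i, 0 < m' i) (hmm : ∀ i, c ≤ m i * m' i)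
    (hp : ∀ i, ∀ x ∈ korobovLattice d (Nat.nth Nat.Prime i) (a i), x ≠ 0 → m i ≤ ‖x‖)
    (hdual : ∀ i, ∀ y ∈ dualLattice (korobovLattice d (Nat.nth Nat.Prime i) (a i)), y ≠ 0 →
      m' i ≤ ‖y‖) :
    IsQuasiUniformFamily (fun i => Nat.nth Nat.Prime i)
      (fun i => korobovPointSet d (Nat.nth Nat.Prime i) (a i)) where
  subset_unitCube i := rankOnePointSet_subset_unitCube _ _
  two_le i := (Nat.prime_nth_prime i).two_le
  card_eq i := ncard_korobovPointSet hd (Nat.prime_nth_prime i).two_le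
  strictMono i := Nat.nth_strictMono Nat.infinite_setOfPred_prime (Nat.lt_succ_self i)
  growth := ⟨2, one_lt_two, fun i => by exact_mod_cast nth_prime_succ_le_two_mul i⟩
  meshRatio_le := by
    obtain ⟨C, hC, h⟩ := exists_meshRatio_rankOnePointSet_le d
    refine ⟨C / c, by positivity, fun i => ?_⟩
    have h2 := (Nat.prime_nth_prime i).two_le
    have hnt : (korobovPointSet d (Nat.nth Nat.Prime i) (a i)).Nontrivial := by
      refine (Set.one_lt_ncard_iff_nontrivial_and_finite.1 ?_).1
      rw [ncard_korobovPointSet hd h2]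
      exact h2
    refine (h _ _ (m i) (m' i) (hm i) (hm' i) hnt (hp i) (hdual i)).trans ?_
    have := hmm i
    gcongr

end Family

theorem theorem3p3 (d : ℕ) (hd : 1 ≤ d) :
    -- the search with the exact score `λ₁(Λ_a) λ₁(Λ_a^⊥)`
    (∀ a : ℕ → ℕ,
      (∀ i, a i = exhaustiveSearch (exactScore d (Nat.nth Nat.Prime i)) (Nat.nth Nat.Prime i)) →
      (∀ i, a i ∈ Finset.Icc 1 (Nat.nth Nat.Prime i - 1) ∧
        ∀ b ∈ Finset.Icc 1 (Nat.nth Nat.Prime i - 1),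
          exactScore d (Nat.nth Nat.Prime i) b ≤ exactScore d (Nat.nth Nat.Prime i) (a i)) ∧
      IsQuasiUniformFamily (fun i => Nat.nth Nat.Prime i)
        (fun i => korobovPointSet d (Nat.nth Nat.Prime i) (a i))) ∧
    -- the search with the score computed from LLL-reduced bases `B i b` of `Λ_b` and
    -- `B' i b` of `Λ_b^⊥`, whichever reduced bases the reduction returns
    (∀ δ : ℝ, 1 / 4 < δ → δ < 1 →
      ∀ B B' : ℕ → ℕ → Fin d → EuclideanSpace ℝ (Fin d),
      (∀ i, ∀ b ∈ Finset.Icc 1 (Nat.nth Nat.Prime i - 1),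
        (IsLatticeBasis (korobovLattice d (Nat.nth Nat.Prime i) b) (B i b) ∧
          IsLLLReduced δ (B i b)) ∧
        (IsLatticeBasis (dualLattice (korobovLattice d (Nat.nth Nat.Prime i) b)) (B' i b) ∧
          IsLLLReduced δ (B' i b))) →
      ∀ a : ℕ → ℕ,
      (∀ i, a i = exhaustiveSearch (fun b => shortestLength (B i b) * shortestLength (B' i b))
        (Nat.nth Nat.Prime i)) →
      (∀ i, a i ∈ Finset.Icc 1 (Nat.nth Nat.Prime i - 1)) ∧
      IsQuasiUniformFamily (fun i => Nat.nth Nat.Prime i)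
        (fun i => korobovPointSet d (Nat.nth Nat.Prime i) (a i))) := by
  have hd0 : 0 < d := hd
  obtain ⟨c, hc, hgood⟩ := exists_good_korobov_parameter hd0
  have hprime : ∀ i, (Nat.nth Nat.Prime i).Prime := Nat.prime_nth_prime
  constructor
  · intro a ha
    have hex : ∀ i, ∃ b ∈ Finset.Icc 1 (Nat.nth Nat.Prime i - 1),
        c ≤ exactScore d (Nat.nth Nat.Prime i) b := by
      intro i
      obtain ⟨b, hb, m, m', hm, hm', hmm, hp, hdual⟩ := hgood _ (hprime i)
      refine ⟨b, hb, hmm.trans ?_⟩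
      have h1 := le_successiveMinimum_one (rankOneLattice_ne_bot hd0 _ _) hp
      have h2 := le_successiveMinimum_one
        (dualLattice_rankOneLattice_ne_bot hd0 (hprime i).pos _) hdual
      exact mul_le_mul h1 h2 hm'.le (hm.le.trans h1)
    have hmax : ∀ i, ∀ b ∈ Finset.Icc 1 (Nat.nth Nat.Prime i - 1),
        exactScore d (Nat.nth Nat.Prime i) b ≤ exactScore d (Nat.nth Nat.Prime i) (a i) := by
      intro i
      obtain ⟨b, hb, hcb⟩ := hex i
      rw [ha i]
      exact le_exhaustiveSearch _ ⟨b, hb, hc.trans_le hcb⟩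
    refine ⟨fun i => ⟨by rw [ha i]; exact exhaustiveSearch_mem _ (hprime i).two_le, hmax i⟩, ?_⟩
    refine isQuasiUniformFamily_korobovPointSet hd0 hc
      (m := fun i => successiveMinimum (korobovLattice d (Nat.nth Nat.Prime i) (a i)) 1)
      (m' := fun i => successiveMinimum (dualLattice (korobovLattice d (Nat.nth Nat.Prime i) (a i))) 1)
      (fun i => ?_) (fun i => ?_) (fun i => ?_)
      (fun i x hx h0 => successiveMinimum_one_le hx h0)
      (fun i x hx h0 => successiveMinimum_one_le hx h0)
    · have hN : (0 : ℝ) < Nat.nth Nat.Prime i := by exact_mod_cast (hprime i).pos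
      exact lt_of_lt_of_le (by positivity) (le_successiveMinimum_one
        (rankOneLattice_ne_bot hd0 _ _) fun x hx h0 =>
          inv_le_norm_of_mem_rankOneLattice (hprime i).pos hx h0)
    · exact lt_of_lt_of_le one_pos (le_successiveMinimum_one
        (dualLattice_rankOneLattice_ne_bot hd0 (hprime i).pos _) fun x hx h0 =>
          one_le_norm_of_mem_dualLattice (hprime i).pos hx h0)
    · obtain ⟨b, hb, hcb⟩ := hex i
      exact hcb.trans (hmax i b hb)
  · intro δ hδ hδ1 B B' hB a ha
    have hmem : ∀ i, a i ∈ Finset.Icc 1 (Nat.nth Nat.Prime i - 1) := fun i => by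
      rw [ha i]; exact exhaustiveSearch_mem _ (hprime i).two_le
    refine ⟨hmem, ?_⟩
    -- Basis vectors are nonzero lattice vectors, so at the good parameter the LLL score is also at
    -- least `c`, whichever bases are chosen.
    have hscore : ∀ i, c ≤ shortestLength (B i (a i)) * shortestLength (B' i (a i)) := by
      intro i
      obtain ⟨b, hb, m, m', hm, hm', hmm, hp, hdual⟩ := hgood _ (hprime i)
      have h1 := le_shortestLength hd0 (hB i b hb).1.1 hp
      have h2 := le_shortestLength hd0 (hB i b hb).2.1 hdual
      have hcb : c ≤ shortestLength (B i b) * shortestLength (B' i b) :=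
        hmm.trans (mul_le_mul h1 h2 hm'.le (hm.le.trans h1))
      have := le_exhaustiveSearch (fun b => shortestLength (B i b) * shortestLength (B' i b))
        ⟨b, hb, hc.trans_le hcb⟩ b hb
      rw [← ha i] at this
      exact hcb.trans this
    have hN : ∀ i, (0 : ℝ) < Nat.nth Nat.Prime i := fun i => by exact_mod_cast (hprime i).pos
    have hpos : ∀ i, 0 < shortestLength (B i (a i)) := fun i =>
      lt_of_lt_of_le (one_div_pos.2 (hN i)) (le_shortestLength hd0 (hB i _ (hmem i)).1.1
        fun x hx h0 => inv_le_norm_of_mem_rankOneLattice (hprime i).pos hx h0)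
    have hpos' : ∀ i, 0 < shortestLength (B' i (a i)) := fun i =>
      lt_of_lt_of_le one_pos (le_shortestLength hd0 (hB i _ (hmem i)).2.1
        fun x hx h0 => one_le_norm_of_mem_dualLattice (hprime i).pos hx h0)
    -- Returning from basis lengths to lower bounds for all nonzero lattice vectors costs a factor
    -- `A` on each side.
    set A := (1 / (δ - 1 / 4)) ^ d with hA
    have hApos : 0 < A := by
      have : 0 < δ - 1 / 4 := by linarith
      positivity
    refine isQuasiUniformFamily_korobovPointSet hd0 (c := c / (A * A)) (by positivity)
      (m := fun i => shortestLength (B i (a i)) / A)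
      (m' := fun i => shortestLength (B' i (a i)) / A)
      (fun i => div_pos (hpos i) hApos) (fun i => div_pos (hpos' i) hApos) (fun i => ?_)
      (fun i x hx h0 => ?_) (fun i x hx h0 => ?_)
    · rw [div_mul_div_comm]
      have := hscore i
      gcongr
    · rw [div_le_iff₀' hApos]
      exact shortestLength_le_mul_norm hδ hδ1 (hB i _ (hmem i)).1.1 (hB i _ (hmem i)).1.2 hx h0
    · rw [div_le_iff₀' hApos]
      exact shortestLength_le_mul_norm hδ hδ1 (hB i _ (hmem i)).2.1 (hB i _ (hmem i)).2.2 hx h0
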